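/- A \emph{derivator} is a strict 2-functor $\mathscr D\colon \mathrm{Cat}^{\mathrm{op}}\to\mathrm{CAT}$ (reversing 1-cells but not 2-cells) from small categories to large categories; write $F^*=\mathscr D(F)\colon\mathscr D(B)\to\mathscr D(A)$ for a functor $F\colon A\to B$ of small categories. It satisfies the following axioms, in which $\mathbb 1$ is the terminal category and $a\colon\mathbb 1\to A$ is the functor picking out an object $a\in A$. (1) For every small family $(A_i)$ of small categories, the canonical functor $\mathscr D(\coprod_i A_i)\to\prod_i\mathscr D(A_i)$ is an equivalence. (2) For every small category $A$, the underlying-diagram functor $\mathscr D(A)\to\mathscr D(\mathbb 1)^A$, $X\mapsto(a\mapsto a^*X)$, in which a morphism $a\to b$ of $A$ acts through the induced 2-cell $a\Rightarrow b$, is conservative. (3) Every $F^*$ has a left adjoint $F_!$ and a right adjoint $F_*$. (4) For every functor $F\colon A\to C$ of small categories and every object $c$ of $C$, with projections $p\colon(F/c)\to A$, $q\colon(F/c)\to\mathbb 1$ and $p'\colon(c/F)\to\mathbb 1$, $q'\colon(c/F)\to A$ of the comma categories, the canonical mates $q_!p^*\to c^*F_!$ and $c^*F_*\to p'_*q'^*$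 are isomorphisms. The derivator $\mathscr D$ is \emph{semi-additive} if the category $\mathscr D(\mathbb 1)$ has finite biproducts, and a semi-additive derivator is \emph{$n$-divisible} if for every object $X$ of $\mathscr D(\mathbb 1)$ the endomorphism $n\cdot\mathrm{id}_X=\mathrm{id}_X+\cdots+\mathrm{id}_X$ is invertible. \textbf{Theorem.} Let $G$ be a finite group, let $BG$ be the corresponding one-object category, and let $\mathscr D$ be a semi-additive and $|G|$-divisible derivator. Then the underlying-diagram functor \[\mathscr D(BG)\to\mathscr D(\mathbb 1)^{BG}\] is fully faithful. -/

import Mathlib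

open CategoryTheory CategoryTheory.Limits Opposite

universe w v u

set_option linter.checkUnivs false in
/-- A prederivator: a strict 2-functor `D : Cat^op → CAT` from the 2-category of (`w`-)small
categories, with 1-cells reversed and 2-cells not reversed, to the 2-category of large categories. -/
abbrev Prederivator := StrictPseudofunctor (Cat.{w, w})ᵒᵖ Cat.{v, u}

namespace Prederivator

variable (D : Prederivator.{w, v, u})

/-- The category `D(A)` of coherent diagrams of shape `A`. -/
abbrev dia (A : Type w) [SmallCategory A] : Cat.{v, u} := D.obj (op (Cat.of A))

/-- The underlying category `D(𝟙)`, where `𝟙` is the terminal category. -/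
abbrev underlying : Cat.{v, u} := D.dia (Discrete PUnit.{w + 1})

section

variable {A B : Type w} [SmallCategory A] [SmallCategory B]

/-- The restriction functor `F^* = D(F) : D(B) → D(A)` along `F : A → B`. -/
def pull (F : A ⥤ B) : D.dia B ⥤ D.dia A := (D.map F.toCatHom.op).toFunctor

/-- The natural transformation `F^* → G^*` induced by a natural transformation `F → G`. -/
def pullMap {F G : A ⥤ B} (α : F ⟶ G) : D.pull F ⟶ D.pull G :=
  (D.map₂ (Bicategory.Opposite.op2 α.toCatHom₂)).toNatTrans

/-- The structure isomorphism (an identity, since `D` is strict) `(F ⋙ G)^* ≅ F^* ∘ G^*`. -/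
def pullComp {C : Type w} [SmallCategory C] (F : A ⥤ B) (G : B ⥤ C) :
    D.pull (F ⋙ G) ≅ D.pull G ⋙ D.pull F :=
  Cat.Hom.toNatIso (D.mapComp G.toCatHom.op F.toCatHom.op)

end

/-- The restriction `a^* : D(A) → D(𝟙)` along the functor `𝟙 → A` picking out `a`. -/
abbrev eval {A : Type w} [SmallCategory A] (a : A) : D.dia A ⥤ D.underlying :=
  D.pull (Functor.fromPUnit.{w} a)

/-- The 2-cell between functors `𝟙 → A` given by a morphism of `A`. -/
abbrev pointMap {A : Type w} [SmallCategory A] {a b : A} (f : a ⟶ b) :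
    Functor.fromPUnit.{w} a ⟶ Functor.fromPUnit.{w} b :=
  Discrete.natTrans (fun _ => f)

/-- The underlying diagram functor `D(A) → D(𝟙)^A`: it sends `X` to the diagram
`a ↦ a^* X`, whose action on morphisms of `A` comes from the action of `D` on 2-cells. -/
def underlyingDiagram (A : Type w) [SmallCategory A] : D.dia A ⥤ (A ⥤ D.underlying) where
  obj X :=
    { obj := fun a => (D.eval a).obj X
      map := fun f => (D.pullMap (pointMap f)).app X
      map_id := fun a => by
        have h : pointMap (𝟙 a) = 𝟙 (Functor.fromPUnit.{w} a) := by ext; rfl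
        rw [h]
        simp [pullMap]
        rfl
      map_comp := fun {a b c} f g => by
        have h : pointMap (f ≫ g) = pointMap f ≫ pointMap g := by ext; rfl
        rw [h]
        simp [pullMap]
        rfl }
  map φ :=
    { app := fun a => (D.eval a).map φ
      naturality := fun _ _ f => ((D.pullMap (pointMap f)).naturality φ).symm }
  map_id X := by ext a; exact (D.eval a).map_id X
  map_comp φ ψ := by ext a; exact (D.eval a).map_comp φ ψ

/-- The image under `D` of a square of small categories
```
      Q
   P₀ → B
 P |  ⇗  | V
   v     v
   A  →  C
      U
```
filled by `α : U ∘ P ⇒ V ∘ Q`, namely `P^* ∘ U^* ⇒ Q^* ∘ V^*`. -/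
def pullSquare {P₀ A B C : Type w} [SmallCategory P₀] [SmallCategory A] [SmallCategory B]
    [SmallCategory C] {P : P₀ ⥤ A} {Q : P₀ ⥤ B} {U : A ⥤ C} {V : B ⥤ C}
    (α : P ⋙ U ⟶ Q ⋙ V) : TwoSquare (D.pull U) (D.pull V) (D.pull P) (D.pull Q) :=
  TwoSquare.mk _ _ _ _ ((D.pullComp P U).inv ≫ D.pullMap α ≫ (D.pullComp Q V).hom)

/-- The axioms of a derivator, for a prederivator `D`. -/
structure IsDerivator : Prop where
  /-- `D` takes coproducts of small categories to products: the functor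
  `D(∐ᵢ Aᵢ) → ∏ᵢ D(Aᵢ)` is an equivalence. -/
  coproducts : ∀ (ι : Type w) (A : ι → Type w) [∀ i, SmallCategory (A i)],
    (Functor.pi' (fun i => D.pull (Sigma.incl (C := A) i))).IsEquivalence
  /-- The underlying diagram functors are conservative. -/
  conservative : ∀ (A : Type w) [SmallCategory A], (D.underlyingDiagram A).ReflectsIsomorphisms
  /-- Every restriction functor `F^*` has a left adjoint `F_!`. -/
  hasLeftAdjoint : ∀ {A B : Type w} [SmallCategory A] [SmallCategory B] (F : A ⥤ B),
    (D.pull F).IsRightAdjoint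
  /-- Every restriction functor `F^*` has a right adjoint `F_*`. -/
  hasRightAdjoint : ∀ {A B : Type w} [SmallCategory A] [SmallCategory B] (F : A ⥤ B),
    (D.pull F).IsLeftAdjoint
  /-- Left Kan extensions are pointwise: for `U : A → C` and an object `c : 𝟙 → C`, with
  projections `p : (U/c) → A` and `q : (U/c) → 𝟙` of the comma category, the canonical
  mate `q_! p^* → c^* U_!` is an isomorphism. -/
  leftKan : ∀ {A C : Type w} [SmallCategory A] [SmallCategory C] (U : A ⥤ C)
    (c : Discrete PUnit.{w + 1} ⥤ C)
    (Ul : D.dia A ⥤ D.dia C) (adjU : Ul ⊣ D.pull U)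
    (ql : D.dia (Comma U c) ⥤ D.underlying) (adjq : ql ⊣ D.pull (Comma.snd U c)),
    IsIso ((mateEquiv adjU adjq).symm (D.pullSquare (Comma.natTrans U c))).natTrans
  /-- Right Kan extensions are pointwise: for `V : B → C` and an object `c : 𝟙 → C`, with
  projections `p : (c/V) → 𝟙` and `q : (c/V) → B` of the comma category, the canonical
  mate `c^* V_* → p_* q^*` is an isomorphism. -/
  rightKan : ∀ {B C : Type w} [SmallCategory B] [SmallCategory C] (V : B ⥤ C)
    (c : Discrete PUnit.{w + 1} ⥤ C)
    (Vr : D.dia B ⥤ D.dia C) (adjV : D.pull V ⊣ Vr)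
    (pr : D.dia (Comma c V) ⥤ D.underlying) (adjp : D.pull (Comma.fst c V) ⊣ pr),
    IsIso (mateEquiv adjV adjp (D.pullSquare (Comma.natTrans c V))).natTrans

end Prederivator

/-- A semi-additive category is `n`-divisible if `n = 𝟙 + ⋯ + 𝟙` is invertible on every object,
for the addition of morphisms defined by the biproducts. -/
def IsDivisible (C : Type u) [Category.{v} C] [HasZeroMorphisms C] [HasFiniteBiproducts C]
    (n : ℕ) : Prop :=
  ∀ X : C,
    haveI := hasBinaryBiproducts_of_finite_biproducts C
    letI := SemiadditiveOfBinaryBiproducts.addCommMonoidHomOfHasBinaryBiproducts X X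
    IsIso (n • 𝟙 X)

/-- The one-object category `BG` of a group `G`, placed in the universe of small categories. -/
abbrev ClassifyingCategory (G : Type w) [Group G] : Type w := AsSmall.{w} (SingleObj G)

namespace Prederivator

variable (D : Prederivator.{w, v, u})

/-! ### Strict 2-functoriality of restriction -/

section

variable {A B C : Type w} [SmallCategory A] [SmallCategory B] [SmallCategory C]

/-! Let `e` be the object of `BG`. The comma category `e/e` is discrete on `G`, so the Kan formulas
make `e^* e_! Z` a copower and `e^* e_* Z` a power of `Z` over `G` (`bijective_unit_act`,
`bijective_act_counit`). By biproducts and conservativity, the norm `e_! Z ⟶ e_* Z`, whose matrix is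
the identity, is invertible. The transfer `X ⟶ e_* e^* X ≅ e_! e^* X ⟶ X` becomes `∑ g⁻¹ g = |G|`
under `e^*`, hence is invertible, so the counit `e_! e^* X ⟶ X` is split epi (`isSplitEpi_counit`).
An equivariant map then lifts through a section of the counit, and uniquely since the counit is epi
(`full_faithful_of_isSplitEpi_counit`). -/

theorem pull_comp (F : A ⥤ B) (G : B ⥤ C) : D.pull (F ⋙ G) = D.pull G ⋙ D.pull F :=
  congrArg Cat.Hom.toFunctor (D.map_comp G.toCatHom.op F.toCatHom.op)

theorem pull_id : D.pull (𝟭 A) = 𝟭 _ :=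
  congrArg Cat.Hom.toFunctor (D.map_id (op (Cat.of A)))

theorem toNatTrans_eqToHom_app {X Y : Cat.{v, u}} {f g : X ⟶ Y} (h : f = g) (x : X) :
    (eqToHom h).toNatTrans.app x = eqToHom (by rw [h]) := by
  subst h; rfl

theorem pullComp_hom_app (F : A ⥤ B) (G : B ⥤ C) (X : D.dia C) :
    (D.pullComp F G).hom.app X = eqToHom (by rw [D.pull_comp]) := by
  simp only [pullComp, D.mapComp_eq_eqToIso]
  exact toNatTrans_eqToHom_app _ _

theorem pullComp_inv_app (F : A ⥤ B) (G : B ⥤ C) (X : D.dia C) :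
    (D.pullComp F G).inv.app X = eqToHom (by rw [D.pull_comp]) := by
  simp only [pullComp, D.mapComp_eq_eqToIso]
  exact toNatTrans_eqToHom_app _ _

/-- Restriction is functorial in the 2-cell. -/
@[simps]
def pullFunctor (A B : Type w) [SmallCategory A] [SmallCategory B] :
    (A ⥤ B) ⥤ (D.dia B ⥤ D.dia A) where
  obj F := D.pull F
  map α := D.pullMap α
  map_id F := by simp [pullMap]; rfl
  map_comp α β := by simp [pullMap]; rfl

/-- `D` reverses 1-cells, so this is compatibility with whiskering on the right in the opposite
bicategory. -/
theorem pullMap_whiskerLeft_app (F : A ⥤ B) {G H : B ⥤ C} (β : G ⟶ H) (X : D.dia C) :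
    (D.pullMap (Functor.whiskerLeft F β)).app X =
      (D.pullComp F G).hom.app X ≫ (D.pull F).map ((D.pullMap β).app X) ≫
        (D.pullComp F H).inv.app X := by
  have h := D.map₂_whisker_right (Bicategory.Opposite.op2 β.toCatHom₂) F.toCatHom.op
  have h' := congrArg (fun t => t.toNatTrans.app X) h
  exact h'

theorem isEquivalence_pull (F : A ⥤ B) [F.IsEquivalence] : (D.pull F).IsEquivalence := by
  let e := F.asEquivalence
  exact (CategoryTheory.Equivalence.mk (D.pull F) (D.pull e.inverse)
    (eqToIso D.pull_id.symm ≪≫ (D.pullFunctor _ _).mapIso e.counitIso.symm ≪≫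
      D.pullComp e.inverse F)
    ((D.pullComp F e.inverse).symm ≪≫ (D.pullFunctor _ _).mapIso e.unitIso.symm ≪≫
      eqToIso D.pull_id)).isEquivalence_functor

end

end Prederivator

/-! ### Discreteness of comma categories of points -/

namespace CategoryTheory

/-- Lets the coproduct axiom apply to any discrete category. -/
theorem isEquivalence_sigmaDesc_fromPUnit (J : Type w) [SmallCategory J] [IsDiscrete J] :
    (Sigma.desc (fun j : J => Functor.fromPUnit.{w} j)).IsEquivalence where
  faithful := ⟨by
    rintro ⟨i, ⟨⟨⟩⟩⟩ ⟨_, ⟨⟨⟩⟩⟩ ⟨f⟩ g _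
    obtain ⟨g, rfl⟩ := (Sigma.incl i).map_surjective g
    exact congrArg _ (Subsingleton.elim f g)⟩
  full := ⟨by
    rintro ⟨i, ⟨⟨⟩⟩⟩ ⟨j, ⟨⟨⟩⟩⟩ f
    obtain rfl : i = j := IsDiscrete.eq_of_hom f
    exact ⟨𝟙 _, Subsingleton.elim _ _⟩⟩
  essSurj := ⟨fun j => ⟨⟨j, ⟨⟨⟩⟩⟩, ⟨Iso.refl _⟩⟩⟩

/-- The outer components of a morphism are identities of the point, so its commuting square forces
equal structure arrows. -/
instance isDiscrete_comma_fromPUnit {C : Type w} [SmallCategory C] (x y : C) :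
    IsDiscrete (Comma (.fromPUnit x) (.fromPUnit y)) where
  subsingleton _ _ := ⟨fun _ _ => CommaMorphism.ext (Subsingleton.elim _ _) (Subsingleton.elim _ _)⟩
  eq_of_hom {X Y} f := by
    obtain ⟨⟨⟨⟩⟩, ⟨⟨⟩⟩, a⟩ := X
    obtain ⟨⟨⟨⟩⟩, ⟨⟨⟩⟩, b⟩ := Y
    have h : a = b := by simpa using f.w.symm
    rw [h]

end CategoryTheory

/-! ### Kan extensions along a point as (co)powers -/

namespace Prederivator

variable {D : Prederivator.{w, v, u}}

/-- The action of a morphism of `A` on the values of a coherent diagram. -/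
abbrev act (D : Prederivator.{w, v, u}) {A : Type w} [SmallCategory A] {a b : A} (f : a ⟶ b) :
    D.eval a ⟶ D.eval b :=
  D.pullMap (pointMap f)

/-- On a discrete category, a morphism of coherent diagrams is a family of morphisms. -/
theorem IsDerivator.bijective_eval (hD : D.IsDerivator) {J : Type w} [SmallCategory J]
    [IsDiscrete J] (M N : D.dia J) :
    Function.Bijective (fun (φ : M ⟶ N) (j : J) => (D.eval j).map φ) := by
  have h₁ := hD.coproducts J (fun _ => Discrete PUnit.{w + 1})
  let K : (Σ _ : J, Discrete PUnit.{w + 1}) ⥤ J := Sigma.desc (fun j => Functor.fromPUnit.{w} j)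
  have : K.IsEquivalence := isEquivalence_sigmaDesc_fromPUnit J
  have h₂ := D.isEquivalence_pull K
  let Φ := D.pull K ⋙ Functor.pi' (fun j : J =>
    D.pull (Sigma.incl (C := fun _ : J => Discrete PUnit.{w + 1}) j))
  have hΦ : Φ = Functor.pi' (fun j : J => D.eval j) := by
    refine Functor.pi_ext _ _ fun j => ?_
    exact (D.pull_comp (Sigma.incl (C := fun _ : J => Discrete PUnit.{w + 1}) j) K).symm
  have h₃ : Φ.IsEquivalence := inferInstance
  rw [hΦ] at h₃
  exact ⟨(Functor.pi' (fun j : J => D.eval j)).map_injective,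
    (Functor.pi' (fun j : J => D.eval j)).map_surjective⟩

section

variable {C : Type w} [SmallCategory C] {x y : C}

/-- The object of the comma category of two points given by a morphism. -/
abbrev commaPoint (f : x ⟶ y) : Comma (.fromPUnit x) (.fromPUnit y) where
  left := ⟨⟨⟩⟩
  right := ⟨⟨⟩⟩
  hom := f

theorem pull_fst_comp_eval (f : x ⟶ y) :
    D.pull (Comma.fst _ _) ⋙ D.eval (commaPoint f) = 𝟭 _ :=
  (D.pull_comp _ _).symm.trans D.pull_id

theorem pull_snd_comp_eval (f : x ⟶ y) :
    D.pull (Comma.snd _ _) ⋙ D.eval (commaPoint f) = 𝟭 _ :=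
  (D.pull_comp _ _).symm.trans D.pull_id

/-- The universal 2-cell of the comma square, whiskered with the point `f`, is `f` itself. -/
theorem eval_map_pullSquare (f : x ⟶ y) (X : D.dia C) :
    (D.eval (commaPoint f)).map ((D.pullSquare (Comma.natTrans (Functor.fromPUnit.{w} x)
      (Functor.fromPUnit.{w} y))).natTrans.app X) =
    (eqToHom (pull_fst_comp_eval f)).app _ ≫ (D.act f).app X ≫
      (eqToHom (pull_snd_comp_eval f).symm).app _ := by
  have h := D.pullMap_whiskerLeft_app (Functor.fromPUnit.{w} (commaPoint f))
    (Comma.natTrans (Functor.fromPUnit.{w} x) (Functor.fromPUnit.{w} y)) X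
  have h' : Functor.whiskerLeft (Functor.fromPUnit.{w} (commaPoint f))
    (Comma.natTrans (Functor.fromPUnit.{w} x) (Functor.fromPUnit.{w} y)) = pointMap f := by
    ext; rfl
  rw [h'] at h
  change (D.act f).app X = _ at h
  rw [h]
  simp [pullSquare, pullComp_hom_app, pullComp_inv_app, eqToHom_map, eqToHom_app]

/-- A morphism between constant diagrams on the comma category of two points is a family of
morphisms indexed by `x ⟶ y`. -/
theorem IsDerivator.bijective_comma (hD : D.IsDerivator) (x y : C) (Z W : D.underlying) :
    Function.Bijective (fun (ψ : (D.pull (Comma.fst (.fromPUnit x)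
        (.fromPUnit y))).obj Z ⟶ (D.pull (Comma.snd _ _)).obj W) (f : x ⟶ y) =>
      (eqToHom (pull_fst_comp_eval f).symm).app Z ≫ (D.eval (commaPoint f)).map ψ ≫
        (eqToHom (pull_snd_comp_eval f)).app W) := by
  have h := hD.bijective_eval
    ((D.pull (Comma.fst (.fromPUnit x) (.fromPUnit y))).obj Z)
    ((D.pull (Comma.snd _ _)).obj W)
  refine ⟨fun ψ χ hψ => h.1 ?_, fun a => ?_⟩
  · funext j
    obtain ⟨⟨⟨⟩⟩, ⟨⟨⟩⟩, f⟩ := j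
    have := congrFun hψ f
    simpa only [cancel_epi, cancel_mono] using this
  · obtain ⟨ψ, hψ⟩ := h.2 (fun j => (eqToHom (pull_fst_comp_eval j.hom)).app Z ≫ a j.hom ≫
      (eqToHom (pull_snd_comp_eval j.hom).symm).app W)
    refine ⟨ψ, funext fun f => ?_⟩
    have := congrFun hψ (commaPoint f)
    dsimp only at this ⊢
    rw [this]
    simp [eqToHom_app]

/-- `y^* x_! Z` is the coproduct of copies of `Z` indexed by the morphisms `x ⟶ y`. -/
theorem IsDerivator.bijective_unit_act (hD : D.IsDerivator) {L : D.underlying ⥤ D.dia C}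
    (adj : L ⊣ D.eval x) (Z W : D.underlying) :
    Function.Bijective (fun (φ : (D.eval y).obj (L.obj Z) ⟶ W) (f : x ⟶ y) =>
      adj.unit.app Z ≫ (D.act f).app (L.obj Z) ≫ φ) := by
  have := hD.hasLeftAdjoint (Comma.snd (.fromPUnit x) (.fromPUnit y))
  let adjq := Adjunction.ofIsRightAdjoint (D.pull (Comma.snd (.fromPUnit x) (.fromPUnit y)))
  have hK := hD.leftKan (.fromPUnit x) (.fromPUnit y) L adj _ adjq
  let m : _ ⟶ (D.eval y).obj (L.obj Z) :=
    ((mateEquiv adj adjq).symm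
      (D.pullSquare (Comma.natTrans (.fromPUnit x) (.fromPUnit y)))).natTrans.app Z
  have hm : IsIso m := NatIso.isIso_app_of_isIso _ _
  -- The map factors as composition with the invertible mate `m`, transposition along `adjq`, and
  -- evaluation at the points of the comma category.
  have hb := (hD.bijective_comma x y Z W).comp
    ((adjq.homEquiv _ W).bijective.comp ((asIso m).homFromEquiv (Z := W)).symm.bijective)
  refine (congrArg Function.Bijective (funext fun φ => funext fun f => ?_)).mpr hb
  have hu := unit_mateEquiv_symm adj adjq
    (D.pullSquare (Comma.natTrans (.fromPUnit x) (.fromPUnit y))) Z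
  change _ = adjq.unit.app _ ≫ (D.pull (Comma.snd (.fromPUnit x) (.fromPUnit y))).map m at hu
  have hs := eval_map_pullSquare f (L.obj Z)
  have hη := (eqToHom (pull_fst_comp_eval (D := D) f)).naturality (adj.unit.app Z)
  have hφ := (eqToHom (pull_snd_comp_eval (D := D) f)).naturality φ
  have hc : adjq.homEquiv _ W (m ≫ φ) =
      (D.pull (Comma.fst (.fromPUnit x) (.fromPUnit y))).map (adj.unit.app Z) ≫
        (D.pullSquare (Comma.natTrans (.fromPUnit x) (.fromPUnit y))).natTrans.app (L.obj Z) ≫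
          (D.pull (Comma.snd (.fromPUnit x) (.fromPUnit y))).map φ := by
    rw [Adjunction.homEquiv_unit, Functor.map_comp, ← Category.assoc, ← hu, Category.assoc]
  change _ = _ ≫ (D.eval (commaPoint f)).map (adjq.homEquiv _ W (m ≫ φ)) ≫ _
  rw [hc, Functor.map_comp, Functor.map_comp, hs]
  simp only [Functor.comp_map, Functor.id_map, Functor.id_obj] at hη hφ
  simp only [Category.assoc, hφ, reassoc_of% hη]
  simp [eqToHom_app]

/-- `y^* x_* Z` is the product of copies of `Z` indexed by the morphisms `y ⟶ x`. -/
theorem IsDerivator.bijective_act_counit (hD : D.IsDerivator) {R : D.underlying ⥤ D.dia C}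
    (adj : D.eval x ⊣ R) (Z W : D.underlying) :
    Function.Bijective (fun (φ : W ⟶ (D.eval y).obj (R.obj Z)) (f : y ⟶ x) =>
      φ ≫ (D.act f).app (R.obj Z) ≫ adj.counit.app Z) := by
  have := hD.hasRightAdjoint (Comma.fst (.fromPUnit y) (.fromPUnit x))
  let adjp := Adjunction.ofIsLeftAdjoint (D.pull (Comma.fst (.fromPUnit y) (.fromPUnit x)))
  have hK := hD.rightKan (.fromPUnit x) (.fromPUnit y) R adj _ adjp
  let m : (D.eval y).obj (R.obj Z) ⟶ _ :=
    (mateEquiv adj adjp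
      (D.pullSquare (Comma.natTrans (.fromPUnit y) (.fromPUnit x)))).natTrans.app Z
  have hm : IsIso m := NatIso.isIso_app_of_isIso _ _
  have hb := (hD.bijective_comma y x W Z).comp
    ((adjp.homEquiv W _).symm.bijective.comp ((asIso m).homToEquiv (Z := W)).bijective)
  refine (congrArg Function.Bijective (funext fun φ => funext fun f => ?_)).mpr hb
  have hu := mateEquiv_counit adj adjp
    (D.pullSquare (Comma.natTrans (.fromPUnit y) (.fromPUnit x))) Z
  change (D.pull (Comma.fst (.fromPUnit y) (.fromPUnit x))).map m ≫ adjp.counit.app _ = _ at hu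
  have hs := eval_map_pullSquare f (R.obj Z)
  have hη := (eqToHom (pull_snd_comp_eval (D := D) f)).naturality (adj.counit.app Z)
  have hφ := (eqToHom (pull_fst_comp_eval (D := D) f)).naturality φ
  have hc : (adjp.homEquiv W _).symm (φ ≫ m) =
      (D.pull (Comma.fst (.fromPUnit y) (.fromPUnit x))).map φ ≫
        (D.pullSquare (Comma.natTrans (.fromPUnit y) (.fromPUnit x))).natTrans.app (R.obj Z) ≫
          (D.pull (Comma.snd (.fromPUnit y) (.fromPUnit x))).map (adj.counit.app Z) := by
    rw [Adjunction.homEquiv_counit, Functor.map_comp, Category.assoc, hu]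
  change _ = _ ≫ (D.eval (commaPoint f)).map ((adjp.homEquiv W _).symm (φ ≫ m)) ≫ _
  rw [hc, Functor.map_comp, Functor.map_comp, hs]
  simp only [Functor.comp_map, Functor.id_map, Functor.id_obj] at hη hφ
  simp only [Category.assoc, hη, reassoc_of% hφ]
  simp [eqToHom_app]

end

end Prederivator

/-! ### Matrices in semi-additive categories -/

namespace CategoryTheory.SemiadditiveOfBinaryBiproducts

variable {E : Type u} [Category.{v} E] [HasZeroMorphisms E] [HasFiniteBiproducts E]

attribute [local instance] hasBinaryBiproducts_of_finite_biproducts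
attribute [local instance] addCommMonoidHomOfHasBinaryBiproducts

variable {ι : Type*} {X Y Z : E}

theorem comp_sum (s : Finset ι) (f : X ⟶ Y) (g : ι → (Y ⟶ Z)) :
    f ≫ ∑ i ∈ s, g i = ∑ i ∈ s, f ≫ g i :=
  map_sum (AddMonoidHom.mk ⟨fun g : Y ⟶ Z => f ≫ g, comp_zero⟩ (comp_add f)) g s

theorem sum_comp (s : Finset ι) (f : ι → (X ⟶ Y)) (g : Y ⟶ Z) :
    (∑ i ∈ s, f i) ≫ g = ∑ i ∈ s, f i ≫ g :=
  map_sum (AddMonoidHom.mk ⟨fun f : X ⟶ Y => f ≫ g, zero_comp⟩ (fun f k => add_comp f k g)) f s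

theorem biproduct_total [Fintype ι] (A : ι → E) :
    ∑ i, biproduct.π A i ≫ biproduct.ι A i = 𝟙 (⨁ A) := by
  classical
  refine biproduct.hom_ext' _ _ fun j => ?_
  rw [comp_sum, Finset.sum_eq_single j]
  · simp
  · intro i _ hij
    simp [biproduct.ι_π_ne_assoc _ hij.symm]
  · simp

theorem biproduct_lift_desc [Fintype ι] {A : ι → E} (a : ∀ i, X ⟶ A i) (b : ∀ i, A i ⟶ Y) :
    biproduct.lift a ≫ biproduct.desc b = ∑ i, a i ≫ b i := by
  rw [← Category.id_comp (biproduct.desc b), ← biproduct_total, sum_comp, comp_sum]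
  simp

/-- A morphism from a finite copower of `Z` to a finite power of `Z` whose matrix is the identity
matrix is invertible, and composing with its inverse gives a sum of composites. -/
theorem exists_inverse_of_matrix_eq_one [Fintype ι] [DecidableEq ι] {S P : E} (c : ι → (Z ⟶ S))
    (hc : ∀ W : E, Function.Bijective (fun (φ : S ⟶ W) i => c i ≫ φ))
    (p : ι → (P ⟶ Z)) (hp : ∀ W : E, Function.Bijective (fun (φ : W ⟶ P) i => φ ≫ p i))
    (n : S ⟶ P) (hn : ∀ i j, c i ≫ n ≫ p j = if i = j then 𝟙 Z else 0) :
    ∃ n' : P ⟶ S, n ≫ n' = 𝟙 S ∧ n' ≫ n = 𝟙 P ∧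
      ∀ {X Y : E} (a : X ⟶ P) (b : S ⟶ Y), a ≫ n' ≫ b = ∑ i, (a ≫ p i) ≫ c i ≫ b := by
  let s : (⨁ fun _ : ι => Z) ⟶ S := biproduct.desc c
  let t : P ⟶ (⨁ fun _ : ι => Z) := biproduct.lift p
  have h : s ≫ n ≫ t = 𝟙 _ := by
    refine biproduct.hom_ext' _ _ fun i => biproduct.hom_ext _ _ fun j => ?_
    simp [s, t, hn, biproduct.ι_π]
  -- Maps out of `S` are determined after the `c i`, which factor through `s`, where `h` applies.
  have hst : (n ≫ t) ≫ s = 𝟙 S := (hc S).1 <| funext fun i => by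
    have : c i = biproduct.ι (fun _ => Z) i ≫ s := by simp [s]
    simp [this, reassoc_of% h]
  have hts : t ≫ s ≫ n = 𝟙 P := (hp P).1 <| funext fun i => by
    have : p i = t ≫ biproduct.π (fun _ => Z) i := by simp [t]
    simp [this, reassoc_of% h]
  refine ⟨t ≫ s, by simpa using hst, by simpa using hts, fun a b => ?_⟩
  have h₁ : a ≫ t = biproduct.lift fun i => a ≫ p i := by
    refine biproduct.hom_ext _ _ fun i => ?_
    simp [t]
  have h₂ : s ≫ b = biproduct.desc fun i => c i ≫ b := by
    refine biproduct.hom_ext' _ _ fun i => ?_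
    simp [s]
  rw [← biproduct_lift_desc, ← h₁, ← h₂]
  simp

end CategoryTheory.SemiadditiveOfBinaryBiproducts

/-! ### The transfer and the splitting of the counit -/

namespace Prederivator

variable {D : Prederivator.{w, v, u}} {C : Type w} [SmallCategory C]

theorem act_id_app (a : C) (X : D.dia C) : (D.act (𝟙 a)).app X = 𝟙 _ :=
  ((D.underlyingDiagram C).obj X).map_id a

theorem act_comp_app {a b c : C} (f : a ⟶ b) (g : b ⟶ c) (X : D.dia C) :
    (D.act (f ≫ g)).app X = (D.act f).app X ≫ (D.act g).app X :=
  ((D.underlyingDiagram C).obj X).map_comp f g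

theorem act_naturality {a b : C} (f : a ⟶ b) {X Y : D.dia C} (φ : X ⟶ Y) :
    (D.eval a).map φ ≫ (D.act f).app Y = (D.act f).app X ≫ (D.eval b).map φ :=
  (D.act f).naturality φ

theorem act_naturality_assoc {a b : C} (f : a ⟶ b) {X Y : D.dia C} (φ : X ⟶ Y)
    {W : D.underlying} (ψ : (D.eval b).obj Y ⟶ W) :
    (D.eval a).map φ ≫ (D.act f).app Y ≫ ψ = (D.act f).app X ≫ (D.eval b).map φ ≫ ψ := by
  rw [← Category.assoc, act_naturality, Category.assoc]

theorem IsDerivator.isIso_of_isIso_eval (hD : D.IsDerivator) {X Y : D.dia C} (φ : X ⟶ Y)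
    (h : ∀ c : C, IsIso ((D.eval c).map φ)) : IsIso φ := by
  have := hD.conservative C
  have : ∀ c, IsIso (((D.underlyingDiagram C).map φ).app c) := h
  have : IsIso ((D.underlyingDiagram C).map φ) := NatIso.isIso_of_isIso_app _
  exact isIso_of_reflects_iso φ (D.underlyingDiagram C)

variable [Subsingleton C]

/-- If the counit `e_! e^* ⟶ 𝟭` is a split epimorphism, for `e` the only object of `C`, then
the underlying diagram functor is fully faithful. -/
theorem IsDerivator.full_faithful_of_isSplitEpi_counit (hD : D.IsDerivator) (e : C)
    {L : D.underlying ⥤ D.dia C} (adj : L ⊣ D.eval e)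
    (h : ∀ X, IsSplitEpi (adj.counit.app X)) :
    (D.underlyingDiagram C).Full ∧ (D.underlyingDiagram C).Faithful := by
  refine ⟨⟨fun {X Y} α => ?_⟩, ⟨fun {X Y} φ ψ hφ => ?_⟩⟩
  · let α₀ : (D.eval e).obj X ⟶ (D.eval e).obj Y := α.app e
    refine ⟨section_ (adj.counit.app X) ≫ L.map α₀ ≫ adj.counit.app Y, ?_⟩
    -- Tested on the copower inclusions indexed by `f`, this is the equivariance `hα` of `α₀`.
    have key : (D.eval e).map (L.map α₀ ≫ adj.counit.app Y) =
        (D.eval e).map (adj.counit.app X) ≫ α₀ := by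
      apply (hD.bijective_unit_act adj _ _).1
      funext f
      have hα : (D.act f).app X ≫ α₀ = α₀ ≫ (D.act f).app Y := α.naturality f
      have hη := adj.unit_naturality α₀
      have hX := adj.right_triangle_components X
      have hY := adj.right_triangle_components Y
      dsimp only
      rw [← act_naturality, ← act_naturality_assoc]
      simp only [Functor.id_obj]
      rw [hα, Functor.map_comp, Category.assoc]
      rw [reassoc_of% hη, reassoc_of% hY, reassoc_of% hX]
    ext c
    obtain rfl := Subsingleton.elim e c
    change (D.eval e).map _ = α₀
    rw [Functor.map_comp, key, ← Category.assoc, ← Functor.map_comp, IsSplitEpi.id,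
      (D.eval e).map_id, Category.id_comp]
  · have h₀ : (D.eval e).map φ = (D.eval e).map ψ := congrArg (fun t => t.app e) hφ
    rw [← cancel_epi (adj.counit.app X)]
    refine (adj.counit_naturality φ).symm.trans (Eq.trans ?_ (adj.counit_naturality ψ))
    rw [h₀]

attribute [local instance] hasBinaryBiproducts_of_finite_biproducts
attribute [local instance] SemiadditiveOfBinaryBiproducts.addCommMonoidHomOfHasBinaryBiproducts

/-- For `C` a finite group, the counit `e_! e^* X ⟶ X` is split by the transfer divided by the
order of the group. -/
theorem IsDerivator.isSplitEpi_counit (hD : D.IsDerivator) [IsGroupoid C] (e : C)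
    [HasZeroMorphisms D.underlying] [HasFiniteBiproducts D.underlying] [Finite (e ⟶ e)]
    (hC : IsDivisible D.underlying (Nat.card (e ⟶ e)))
    {L : D.underlying ⥤ D.dia C} (adj : L ⊣ D.eval e) (X : D.dia C) :
    IsSplitEpi (adj.counit.app X) := by
  classical
  have := Fintype.ofFinite (e ⟶ e)
  have := hD.hasRightAdjoint (Functor.fromPUnit.{w} e)
  let adj' := Adjunction.ofIsLeftAdjoint (D.eval e)
  let R := (D.eval e).rightAdjoint
  let Z := (D.eval e).obj X
  let c : (e ⟶ e) → (Z ⟶ (D.eval e).obj (L.obj Z)) := fun f =>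
    adj.unit.app Z ≫ (D.act f).app (L.obj Z)
  -- With `inv f`, the matrix entry of the norm at `(i, j)` depends on `i ≫ inv j`, which is the
  -- identity exactly when `i = j`.
  let p : (e ⟶ e) → ((D.eval e).obj (R.obj Z) ⟶ Z) := fun f =>
    (D.act (inv f)).app (R.obj Z) ≫ adj'.counit.app Z
  have hc (W) : Function.Bijective (fun (φ : (D.eval e).obj (L.obj Z) ⟶ W) i => c i ≫ φ) := by
    simpa only [c, Category.assoc] using hD.bijective_unit_act adj (y := e) Z W
  have hp (W) : Function.Bijective (fun (φ : W ⟶ (D.eval e).obj (R.obj Z)) i => φ ≫ p i) := by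
    let i : (e ⟶ e) ≃ (e ⟶ e) :=
      ⟨fun f => inv f, fun f => inv f, fun f => by simp, fun f => by simp⟩
    exact (i.arrowCongr (Equiv.refl (W ⟶ Z))).bijective.comp
      (hD.bijective_act_counit adj' (y := e) Z W)
  -- The transpose of the norm: coordinate `𝟙 Z` at the identity and zero elsewhere.
  obtain ⟨t, ht⟩ := (hD.bijective_act_counit adj' (y := e) Z Z).2
    (fun f => if f = 𝟙 e then 𝟙 Z else 0)
  let N : L.obj Z ⟶ R.obj Z := (adj.homEquiv _ _).symm t
  have hN : adj.unit.app Z ≫ (D.eval e).map N = t :=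
    (adj.homEquiv_unit _ _ _).symm.trans (Equiv.apply_symm_apply _ _)
  have hn (i j) : c i ≫ (D.eval e).map N ≫ p j = if i = j then 𝟙 Z else 0 := by
    have h := congrFun ht (i ≫ inv j)
    have hij : i ≫ inv j = 𝟙 e ↔ i = j := by rw [IsIso.comp_inv_eq, Category.id_comp]
    simp only [hij] at h
    rw [← h, act_comp_app, ← hN]
    simp only [c, p, Category.assoc]
    rw [← act_naturality_assoc]
  obtain ⟨n, hn₁, hn₂, hsum⟩ :=
    SemiadditiveOfBinaryBiproducts.exists_inverse_of_matrix_eq_one c hc p hp _ hn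
  have hNiso : IsIso N := hD.isIso_of_isIso_eval N fun a => by
    obtain rfl := Subsingleton.elim e a
    exact ⟨n, hn₁, hn₂⟩
  have hinv : (D.eval e).map (inv N) = n := by
    rw [Functor.map_inv]
    exact IsIso.inv_eq_of_hom_inv_id hn₁
  let τ : X ⟶ X := adj'.unit.app X ≫ inv N ≫ adj.counit.app X
  have hτ : (D.eval e).map τ = Nat.card (e ⟶ e) • 𝟙 Z := by
    -- The `i`-th summand acts by `inv i` and then by `i`.
    have hterm (i : e ⟶ e) : ((D.eval e).map (adj'.unit.app X) ≫ p i) ≫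
        c i ≫ (D.eval e).map (adj.counit.app X) = 𝟙 Z := by
      have h₁ := adj'.left_triangle_components X
      have h₂ := adj.right_triangle_components X
      have hp' : (D.eval e).map (adj'.unit.app X) ≫ p i = (D.act (inv i)).app X :=
        (act_naturality_assoc (inv i) (adj'.unit.app X) _).trans
          ((congrArg _ h₁).trans (Category.comp_id _))
      have hc' : c i ≫ (D.eval e).map (adj.counit.app X) = (D.act i).app X := by
        simp only [c, Category.assoc]
        rw [← act_naturality, reassoc_of% h₂]
        rfl
      rw [hp', hc', ← act_comp_app, IsIso.inv_hom_id, act_id_app]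
    simp only [τ, Functor.map_comp, hinv, hsum, hterm, Finset.sum_const, Finset.card_univ,
      Nat.card_eq_fintype_card]
  have hτiso : IsIso τ := hD.isIso_of_isIso_eval τ fun a => by
    obtain rfl := Subsingleton.elim e a
    rw [hτ]
    exact hC Z
  exact ⟨⟨⟨inv τ ≫ adj'.unit.app X ≫ inv N, by simp [τ]⟩⟩⟩

end Prederivator

instance isGroupoid_classifyingCategory (G : Type w) [Group G] :
    IsGroupoid (ClassifyingCategory G) where
  all_isIso f := by
    have : AsSmall.down.{w, 0, w} (C := SingleObj G) |>.IsEquivalence :=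
      (AsSmall.equiv (C := SingleObj G)).isEquivalence_inverse
    have : IsIso (AsSmall.down.map f) := inferInstance
    exact isIso_of_reflects_iso f AsSmall.down

theorem mainTheorem11 (D : Prederivator.{w, v, u}) (hD : D.IsDerivator)
    [HasZeroMorphisms D.underlying] [HasFiniteBiproducts D.underlying]
    (G : Type w) [Group G] [Finite G] (hG : IsDivisible D.underlying (Nat.card G)) :
    (D.underlyingDiagram (ClassifyingCategory G)).Full ∧
      (D.underlyingDiagram (ClassifyingCategory G)).Faithful := by
  let e : ClassifyingCategory G := AsSmall.up.obj (SingleObj.star G)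
  have : Subsingleton (ClassifyingCategory G) := ⟨fun a b => by cases a; cases b; rfl⟩
  let i : (e ⟶ e) ≃ G := Equiv.ulift
  have : Finite (e ⟶ e) := Finite.of_equiv G i.symm
  rw [← Nat.card_congr i] at hG
  have := hD.hasLeftAdjoint (Functor.fromPUnit.{w} e)
  let adj := Adjunction.ofIsRightAdjoint (D.eval e)
  exact hD.full_faithful_of_isSplitEpi_counit e adj (hD.isSplitEpi_counit e hG adj)
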